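/- **Proposition (Derivatives of the $S$-resolvent operators).** Let $\mathbb{R}_n$ be the real Clifford algebra with units $e_1,\dots,e_n$, $e_ie_j+e_je_i=-2\delta_{ij}$. Identify $s=(s_0,\dots,s_n)\in\mathbb{R}^{n+1}$ with the paravector $s_0+\sum_{j=1}^n s_je_j$, and put $\overline s=s_0-\sum_{j=1}^n s_je_j$, $|s|^2=\sum_{j=0}^n s_j^2$, $\mathbb{S}=\{I\in\mathbb{R}^{n+1}: I_0=0,\ |I|=1\}$. Let $V$ be a real Banach space and $V_n=V\otimes\mathbb{R}_n=\{\sum_A v_Ae_A\}$ with $\|\sum_A v_Ae_A\|^2=\sum_A\|v_A\|^2$. Elements $a\in\mathbb{R}_n$ act on $V_n$ by left multiplication, and bounded operators $T_j$ of $V$ act on $V_n$ coefficientwise. Let $T=T_0+\sum_{j=1}^n e_jT_j$ with $T_0,\dots,T_n\in\mathcal{B}(V)$ be a bounded paravector operator on $V_n$ (the $T_j$ need not commute). Put $Q_s(T)=T^2-2s_0T+|s|^2\mathcal{I}$ and $\rho_S(T)=\{s\in\mathbb{R}^{n+1}: Q_s(T)\text{ is invertible in }\mathcal{B}(V_n)\}$.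 For $s\in\rho_S(T)$ and $k\ge 0$ let $$S_L^{-1}(s,T)=-Q_s(T)^{-1}(T-\overline s\,\mathcal{I}),\qquad S_R^{-1}(s,T)=-(T-\overline s\,\mathcal{I})Q_s(T)^{-1},$$ $$S_L^{-k}(s,T)=Q_s(T)^{-k}(\overline s\,\mathcal{I}-T)^{\star_\ell k},\qquad S_R^{-k}(s,T)=(\overline s\,\mathcal{I}-T)^{\star_r k}Q_s(T)^{-k}.$$ Here the powers are formed with the products $$\Big(\sum_k T^ka_k\Big)\star_\ell\Big(\sum_k T^kb_k\Big)=\sum_k T^k\Big(\sum_{i=0}^k a_ib_{k-i}\Big),\qquad \Big(\sum_k a_kT^k\Big)\star_r\Big(\sum_k b_kT^k\Big)=\sum_k \Big(\sum_{i=0}^k a_ib_{k-i}\Big)T^k,$$ where $a_k,b_k\in\mathbb{R}_n$. A function $f$ from an open set $U\subseteq\mathbb{R}^{n+1}$ that contains with $u+Iv$ all $u+Jv$ $(J\in\mathbb{S})$ to $\mathcal{B}(V_n)$ is called left (right) slice hyperholomorphic if $f(u+Iv)=\alpha(u,v)+I\beta(u,v)$ (respectively $\alpha(u,v)+\beta(u,v)I$)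 for all $I\in\mathbb{S}$, with differentiable $\alpha,\beta$, $\alpha$ even and $\beta$ odd in $v$, and $\partial_u\alpha=\partial_v\beta$, $\partial_u\beta=-\partial_v\alpha$. Its slice derivative is $$\partial_sf(u+Iv)=\tfrac12\big(\partial_uf(u+Iv)-I\,\partial_vf(u+Iv)\big)\quad\text{(left)},\qquad \partial_sf(u+Iv)=\tfrac12\big(\partial_uf(u+Iv)-\partial_vf(u+Iv)\,I\big)\quad\text{(right)},$$ for every $I\in\mathbb{S}$. Then $s\mapsto S_L^{-1}(s,T)$ is right and $s\mapsto S_R^{-1}(s,T)$ is left slice hyperholomorphic on $\rho_S(T)$, all their iterated slice derivatives exist and are again right, respectively left, slice hyperholomorphic there, and for every $m\ge 0$ and $s\in\rho_S(T)$ $$\partial_s^{m}S_L^{-1}(s,T)=(-1)^m\,m!\,S_L^{-(m+1)}(s,T),\qquad \partial_s^{m}S_R^{-1}(s,T)=(-1)^m\,m!\,S_R^{-(m+1)}(s,T).$$ The same two identities hold with $\partial_s^m$ replaced by the iterated partial derivative $\partial^m/\partial s_0^m$, which exists in operator norm. -/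

import Mathlib

open scoped Polynomial symmDiff Nat

noncomputable section

namespace SResolvent

/-! ### Paravectors and the real Clifford algebra `ℝ_n` -/

/-- The quadratic form `x ↦ -(x₁² + ⋯ + x_n²)` on `ℝⁿ`. -/
def negSq (n : ℕ) : QuadraticForm ℝ (Fin n → ℝ) :=
  QuadraticMap.weightedSumSquares ℝ (fun _ : Fin n => (-1 : ℝ))

/-- The real Clifford algebra `ℝ_n` over `n` imaginary units, `e_i e_j + e_j e_i = -2 δ_ij`. -/
abbrev Cl (n : ℕ) : Type := CliffordAlgebra (negSq n)

/-- `ℝ^{n+1}` with its Euclidean norm; the coordinate `0` is the real part. -/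
abbrev Paravector (n : ℕ) : Type := EuclideanSpace ℝ (Fin (n + 1))

/-- The identification of `(x₀, x₁, …, x_n)` with `x₀ + x₁ e₁ + ⋯ + x_n e_n ∈ ℝ_n`. -/
def toCl {n : ℕ} (x : Paravector n) : Cl n :=
  algebraMap ℝ (Cl n) (x 0) + CliffordAlgebra.ι (negSq n) (fun j => x j.succ)

/-- The conjugate `x₀ - x₁ e₁ - ⋯ - x_n e_n`. -/
def conj {n : ℕ} (x : Paravector n) : Paravector n :=
  WithLp.toLp 2 (Fin.cons (x 0) (fun j : Fin n => - x j.succ))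

/-- The real unit `1` as a paravector. -/
def realUnit (n : ℕ) : Paravector n := EuclideanSpace.single 0 1

/-- The sphere `𝕊` of purely imaginary paravectors of norm one. -/
def imagSphere (n : ℕ) : Set (Paravector n) := {I | I 0 = 0 ∧ ‖I‖ = 1}

/-- The paravector `u + I v`. -/
def slicePt {n : ℕ} (I : Paravector n) (u v : ℝ) : Paravector n := u • realUnit n + v • I

/-- A set that contains, with each of its points `u + I v`, the whole sphere
`{u + J v : J ∈ 𝕊}`. -/
def AxiallySymmetric {n : ℕ} (U : Set (Paravector n)) : Prop :=
  ∀ u v : ℝ, ∀ I ∈ imagSphere n, ∀ J ∈ imagSphere n, slicePt I u v ∈ U → slicePt J u v ∈ U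

/-! ### The two-sided module `V_n = V ⊗ ℝ_n` -/

/-- `V_n`: the elements `∑_A v_A e_A` with `v_A ∈ V`, `A ⊆ {1, …, n}`, with the norm
`‖v‖² = ∑_A ‖v_A‖²`. -/
def Vn (n : ℕ) (V : Type*) : Type _ := PiLp 2 (fun _ : Finset (Fin n) => V)

variable {n : ℕ} {V : Type*} [NormedAddCommGroup V] [NormedSpace ℝ V]

instance : NormedAddCommGroup (Vn n V) :=
  inferInstanceAs (NormedAddCommGroup (PiLp 2 (fun _ : Finset (Fin n) => V)))

instance : NormedSpace ℝ (Vn n V) :=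
  inferInstanceAs (NormedSpace ℝ (PiLp 2 (fun _ : Finset (Fin n) => V)))

instance [CompleteSpace V] : CompleteSpace (Vn n V) :=
  inferInstanceAs (CompleteSpace (PiLp 2 (fun _ : Finset (Fin n) => V)))

variable (n V) in
/-- The coefficients `(v_A)` of `∑_A v_A e_A`. -/
def coeffs : Vn n V ≃L[ℝ] (Finset (Fin n) → V) :=
  PiLp.continuousLinearEquiv 2 ℝ (fun _ : Finset (Fin n) => V)

theorem norm_sq_eq (v : Vn n V) : ‖v‖ ^ 2 = ∑ A, ‖coeffs n V v A‖ ^ 2 :=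
  PiLp.norm_sq_eq_of_L2 (fun _ : Finset (Fin n) => V) v

theorem coeffs_ext {v w : Vn n V} (h : ∀ A, coeffs n V v A = coeffs n V w A) : v = w :=
  (coeffs n V).injective (funext h)

/-- The element `v e_A` of `V_n`. -/
def monomial (A : Finset (Fin n)) (v : V) : Vn n V := (coeffs n V).symm (Pi.single A v)

variable (n V) in
/-- The bounded operators on `V_n`. -/
abbrev Op : Type _ := Vn n V →L[ℝ] Vn n V

/-- The sign in `e_j e_B = ± e_{B ∆ {j}}`, where `e_B = e_{i₁} ⋯ e_{i_r}` for
`B = {i₁ < ⋯ < i_r}`: one factor `-1` for each `i ∈ B` with `i < j`, which `e_j` has to pass,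
and one for `e_j e_j = -1` if `j ∈ B`. -/
def unitSign (j : Fin n) (B : Finset (Fin n)) : ℝ := (-1) ^ (B.filter (fun i => i ≤ j)).card

variable (V) in
/-- Left multiplication by `e_j` on `V_n`: `v_B e_B ↦ v_B e_j e_B`. -/
def unitMul (j : Fin n) : Op n V :=
  (coeffs n V).symm.toContinuousLinearMap ∘L
    (ContinuousLinearMap.pi (fun A : Finset (Fin n) =>
      unitSign j (A ∆ {j}) • ContinuousLinearMap.proj (R := ℝ) (A ∆ {j}))) ∘L
    (coeffs n V).toContinuousLinearMap

/-- A bounded operator of `V`, acting on `V_n` coefficientwise: `v_B e_B ↦ S(v_B) e_B`. -/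
def coeffwise (S : V →L[ℝ] V) : Op n V :=
  (coeffs n V).symm.toContinuousLinearMap ∘L
    (ContinuousLinearMap.pi (fun A : Finset (Fin n) =>
      S ∘L ContinuousLinearMap.proj (R := ℝ) A)) ∘L
    (coeffs n V).toContinuousLinearMap

@[simp] theorem coeffs_unitMul (j : Fin n) (v : Vn n V) (A : Finset (Fin n)) :
    coeffs n V (unitMul V j v) A = unitSign j (A ∆ {j}) • coeffs n V v (A ∆ {j}) := by
  simp [unitMul]

@[simp] theorem coeffs_coeffwise (S : V →L[ℝ] V) (v : Vn n V) (A : Finset (Fin n)) :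
    coeffs n V (coeffwise S v) A = S (coeffs n V v A) := by
  simp [coeffwise]

theorem coeffs_monomial (A B : Finset (Fin n)) (v : V) :
    coeffs n V (monomial A v) B = if B = A then v else 0 := by
  simp [monomial, Pi.single_apply]

theorem card_filter_symmDiff (j i : Fin n) (A : Finset (Fin n)) :
    (-1 : ℝ) ^ ((A ∆ {i}).filter (fun k => k ≤ j)).card
      = (if i ≤ j then -1 else 1) * (-1) ^ (A.filter (fun k => k ≤ j)).card := by
  by_cases hi : i ∈ A
  · have h1 : A ∆ {i} = A.erase i := by
      ext k; simp only [Finset.mem_symmDiff, Finset.mem_singleton, Finset.mem_erase]; grind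
    rw [h1, Finset.filter_erase]
    by_cases hij : i ≤ j
    · have hm : i ∈ A.filter (fun k => k ≤ j) := by simp [hi, hij]
      have := Finset.card_erase_add_one hm
      rw [← this, pow_succ]; simp [hij]
    · rw [Finset.erase_eq_of_notMem (by simp [hij])]; simp [hij]
  · have h1 : A ∆ {i} = insert i A := by
      ext k; simp only [Finset.mem_symmDiff, Finset.mem_singleton, Finset.mem_insert]; grind
    rw [h1, Finset.filter_insert]
    by_cases hij : i ≤ j
    · rw [if_pos hij, Finset.card_insert_of_notMem (by simp [hi]), pow_succ]; simp [hij]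
    · simp [hij]

/-- The Clifford relations for the operators of left multiplication by the units. -/
theorem unitMul_anticomm (i j : Fin n) :
    unitMul V i * unitMul V j + unitMul V j * unitMul V i
      = (if i = j then (-2 : ℝ) else 0) • (1 : Op n V) := by
  refine ContinuousLinearMap.ext fun v => coeffs_ext fun A => ?_
  have hs : ∀ k : Fin n, unitSign k A * unitSign k A = 1 := fun k => by
    rw [unitSign, ← mul_pow]; simp
  have key : ∀ k l : Fin n, coeffs n V (unitMul V k (unitMul V l v)) A
      = ((if k ≤ l then -1 else 1) * (unitSign k A * unitSign l A)) • coeffs n V v (A ∆ {k} ∆ {l}) := by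
    intro k l
    rw [coeffs_unitMul, coeffs_unitMul, smul_smul]
    congr 1
    simp only [unitSign, card_filter_symmDiff, le_refl, if_true]
    ring
  change coeffs n V (unitMul V i (unitMul V j v) + unitMul V j (unitMul V i v)) A
    = coeffs n V ((if i = j then (-2 : ℝ) else 0) • v) A
  rw [map_add, map_smul, Pi.add_apply, Pi.smul_apply]
  rw [key, key]
  by_cases hij : i = j
  · subst hij
    rw [symmDiff_symmDiff_cancel_right, hs, ← add_smul]
    norm_num
  · rw [symmDiff_right_comm A {j} {i}, ← add_smul, if_neg hij]
    rcases lt_or_gt_of_ne hij with h | h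
    · rw [if_pos h.le, if_neg (not_le.2 h), mul_comm (unitSign j A)]; simp
    · rw [if_pos h.le, if_neg (not_le.2 h), mul_comm (unitSign j A)]; simp

/-- The linear map `(x₁, …, x_n) ↦ x₁ e₁ + ⋯ + x_n e_n`, as operators on `V_n`. -/
def vectorMul (n : ℕ) (V : Type*) [NormedAddCommGroup V] [NormedSpace ℝ V] :
    (Fin n → ℝ) →ₗ[ℝ] Op n V :=
  ∑ j, (LinearMap.proj j).smulRight (unitMul V j)

theorem vectorMul_apply (x : Fin n → ℝ) : vectorMul n V x = ∑ j, x j • unitMul V j := by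
  simp [vectorMul]

theorem vectorMul_sq (x : Fin n → ℝ) :
    vectorMul n V x * vectorMul n V x
      = algebraMap ℝ (Op n V) (negSq n x) := by
  have h2 : (2 : ℝ) • (vectorMul n V x * vectorMul n V x)
      = (2 : ℝ) • algebraMap ℝ (Op n V) (negSq n x) := by
    have e : vectorMul n V x * vectorMul n V x
        = ∑ i, ∑ j, (x i * x j) • (unitMul V i * unitMul V j) := by
      rw [vectorMul_apply, Finset.sum_mul_sum]
      refine Finset.sum_congr rfl fun i _ => Finset.sum_congr rfl fun j _ => ?_
      exact smul_mul_smul_comm (x i) (unitMul V i) (x j) (unitMul V j)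
    have e' : vectorMul n V x * vectorMul n V x
        = ∑ i, ∑ j, (x i * x j) • (unitMul V j * unitMul V i) := by
      rw [e, Finset.sum_comm]
      simp only [mul_comm]
    rw [two_smul ℝ]
    nth_rewrite 1 [e]
    rw [e']
    simp only [← Finset.sum_add_distrib, ← smul_add, unitMul_anticomm, ite_smul, zero_smul,
      smul_ite, smul_zero, Finset.sum_ite_eq, Finset.mem_univ, if_true, negSq,
      QuadraticMap.weightedSumSquares_apply, Algebra.algebraMap_eq_smul_one, smul_smul,
      ← Finset.sum_smul, Finset.mul_sum]
    congr 1
    refine Finset.sum_congr rfl fun i _ => ?_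
    simp only [smul_eq_mul]; ring
  exact smul_right_injective _ (two_ne_zero' ℝ) h2

/-- Multiplication of `V_n` from the left by the elements of `ℝ_n`. -/
def leftMul (n : ℕ) (V : Type*) [NormedAddCommGroup V] [NormedSpace ℝ V] :
    Cl n →ₐ[ℝ] Op n V :=
  CliffordAlgebra.lift (negSq n) ⟨vectorMul n V, vectorMul_sq⟩

/-- With `e_A = e_{i₁} ⋯ e_{i_r} ∈ ℝ_n` for `A = {i₁ < ⋯ < i_r}`, the product of `e_A` and
`v = v e_∅` is `v e_A`. -/
theorem leftMul_basis (A : Finset (Fin n)) (v : V) :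
    leftMul n V ((A.sort (· ≤ ·)).map
        (fun j => CliffordAlgebra.ι (negSq n) (Pi.single j 1))).prod
      (monomial ∅ v) = monomial A v := by
  induction A using Finset.induction_on_min with
  | empty => simp
  | insert j A hj ih =>
    have hjA : j ∉ A := fun h => lt_irrefl _ (hj j h)
    rw [Finset.sort_insert (r := (· ≤ ·)) (fun b hb => (hj b hb).le) hjA, List.map_cons,
      List.prod_cons, map_mul]
    change leftMul n V _ (leftMul n V _ _) = _
    rw [ih, leftMul, CliffordAlgebra.lift_ι_apply, vectorMul_apply]
    have hs : ∑ k, (Pi.single j 1 : Fin n → ℝ) k • unitMul V k = unitMul V j := by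
      rw [Finset.sum_eq_single j (fun k _ hk => by rw [Pi.single_eq_of_ne hk, zero_smul])
        (by simp), Pi.single_eq_same, one_smul]
    change (∑ k, (Pi.single j 1 : Fin n → ℝ) k • unitMul V k) _ = _
    rw [hs]
    have hA : A ∆ {j} = insert j A := by
      ext k; simp only [Finset.mem_symmDiff, Finset.mem_singleton, Finset.mem_insert]; grind
    refine coeffs_ext fun B => ?_
    rw [coeffs_unitMul, coeffs_monomial, coeffs_monomial]
    by_cases hB : B = insert j A
    · subst hB
      have h1 : insert j A ∆ {j} = A := by rw [← hA, symmDiff_symmDiff_cancel_right]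
      have h2 : A.filter (fun i => i ≤ j) = ∅ := by
        ext k; simpa using fun hk => hj k hk
      rw [h1, if_pos rfl, if_pos rfl, unitSign, h2]; simp
    · have h1 : B ∆ {j} ≠ A := fun h => hB (by rw [← hA, ← h, symmDiff_symmDiff_cancel_right])
      rw [if_neg h1, if_neg hB, smul_zero]

/-- The operator `x 𝓘` on `V_n` for a paravector `x`. -/
def scalarOp (V : Type*) [NormedAddCommGroup V] [NormedSpace ℝ V] {n : ℕ} (x : Paravector n) :
    Op n V :=
  leftMul n V (toCl x)

/-- The set `𝓑^{0,1}(V_n)` of bounded paravector operators `T₀ + e₁ T₁ + ⋯ + e_n T_n`, with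
`T₀, …, T_n` bounded operators on `V`. -/
def paravectorOperators (n : ℕ) (V : Type*) [NormedAddCommGroup V] [NormedSpace ℝ V] :
    Set (Op n V) :=
  {T | ∃ (T₀ : V →L[ℝ] V) (T' : Fin n → V →L[ℝ] V),
    T = coeffwise T₀ + ∑ j, unitMul V j * coeffwise (T' j)}

/-! ### `S`-spectrum, `S`-resolvent operators and their slice hyperholomorphic powers -/

/-- `T² - 2 Re(s) T + |s|² 𝓘`. -/
def quadOp (s : Paravector n) (T : Op n V) : Op n V :=
  T ^ 2 - (2 * s 0) • T + (‖s‖ ^ 2) • (1 : Op n V)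

/-- The `S`-spectrum. -/
def sSpectrum (T : Op n V) : Set (Paravector n) := {s | ¬ IsUnit (quadOp s T)}

/-- The `S`-resolvent set. -/
def sResolventSet (T : Op n V) : Set (Paravector n) := (sSpectrum T)ᶜ

/-- The left `S`-resolvent operator `S_L^{-1}(s,T)` (meaningful for `s` in the `S`-resolvent
set). -/
def leftResolvent (s : Paravector n) (T : Op n V) : Op n V :=
  -(Ring.inverse (quadOp s T) * (T - scalarOp V (conj s)))

/-- The right `S`-resolvent operator `S_R^{-1}(s,T)`. -/
def rightResolvent (s : Paravector n) (T : Op n V) : Op n V :=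
  -((T - scalarOp V (conj s)) * Ring.inverse (quadOp s T))

/-- `∑_k T^k a_k` for the finite sequence `(a_k)` of coefficients of a polynomial over `ℝ_n`.
The `⋆_ℓ`-product of `∑_k T^k a_k` and `∑_k T^k b_k` is `∑_k T^k (∑_{i ≤ k} a_i b_{k-i})`, that
is, the value of the product of the two polynomials in `ℝ_n[X]`, where `X` is central. -/
def leftValue (T : Op n V) (p : (Cl n)[X]) : Op n V :=
  p.sum (fun k a => T ^ k * leftMul n V a)

/-- `∑_k a_k T^k`; products in `ℝ_n[X]` give the `⋆_r`-products. -/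
def rightValue (T : Op n V) (p : (Cl n)[X]) : Op n V :=
  p.sum (fun k a => leftMul n V a * T ^ k)

/-- The power `(x 𝓘 - T)^{⋆_ℓ k}`. -/
def leftStarPow (x : Paravector n) (T : Op n V) (k : ℕ) : Op n V :=
  leftValue T ((Polynomial.C (toCl x) - Polynomial.X) ^ k)

/-- The power `(x 𝓘 - T)^{⋆_r k}`. -/
def rightStarPow (x : Paravector n) (T : Op n V) (k : ℕ) : Op n V :=
  rightValue T ((Polynomial.C (toCl x) - Polynomial.X) ^ k)

/-- `S_L^{-k}(s,T) = (T² - 2 s₀ T + |s|² 𝓘)^{-k} (s̄ 𝓘 - T)^{⋆_ℓ k}`. -/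
def leftResolventPow (k : ℕ) (s : Paravector n) (T : Op n V) :
    Op n V :=
  Ring.inverse (quadOp s T) ^ k * leftStarPow (conj s) T k

/-- `S_R^{-k}(s,T) = (s̄ 𝓘 - T)^{⋆_r k} (T² - 2 s₀ T + |s|² 𝓘)^{-k}`. -/
def rightResolventPow (k : ℕ) (s : Paravector n) (T : Op n V) :
    Op n V :=
  rightStarPow (conj s) T k * Ring.inverse (quadOp s T) ^ k

/-! ### Slice hyperholomorphic functions and slice derivatives

The functions are defined on subsets of `ℝ^{n+1}` and have values in the bounded operators on
`V_n`, which are multiplied by elements of `ℝ_n` from both sides. -/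

/-- `D = {(u,v) : u + I v ∈ U}` for an axially symmetric `U`. -/
def sliceDomain (U : Set (Paravector n)) : Set (ℝ × ℝ) :=
  {p | ∀ I ∈ imagSphere n, slicePt I p.1 p.2 ∈ U}

/-- A pair of differentiable functions on `sliceDomain U`, even respectively odd in the second
variable, that satisfies the Cauchy-Riemann system `∂_u α = ∂_v β`, `∂_u β = -∂_v α`. -/
structure IsStemPair (U : Set (Paravector n)) (α β : ℝ × ℝ → Op n V) : Prop where
  differentiable_fst : ∀ p ∈ sliceDomain U, DifferentiableAt ℝ α p
  differentiable_snd : ∀ p ∈ sliceDomain U, DifferentiableAt ℝ β p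
  even : ∀ u v : ℝ, (u, v) ∈ sliceDomain U → α (u, -v) = α (u, v)
  odd : ∀ u v : ℝ, (u, v) ∈ sliceDomain U → β (u, -v) = -β (u, v)
  cauchyRiemann₁ : ∀ p ∈ sliceDomain U, fderiv ℝ α p (1, 0) - fderiv ℝ β p (0, 1) = 0
  cauchyRiemann₂ : ∀ p ∈ sliceDomain U, fderiv ℝ β p (1, 0) + fderiv ℝ α p (0, 1) = 0

/-- `f` is left slice hyperholomorphic on the axially symmetric open set `U`:
`f(u + I v) = α(u,v) + I β(u,v)`. -/
def LeftSliceHyperholomorphicOn (f : Paravector n → Op n V)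
    (U : Set (Paravector n)) : Prop :=
  IsOpen U ∧ AxiallySymmetric U ∧ ∃ α β, IsStemPair U α β ∧
    ∀ I ∈ imagSphere n, ∀ u v : ℝ, slicePt I u v ∈ U →
      f (slicePt I u v) = α (u, v) + scalarOp V I * β (u, v)

/-- `f` is right slice hyperholomorphic on the axially symmetric open set `U`:
`f(u + I v) = α(u,v) + β(u,v) I`. -/
def RightSliceHyperholomorphicOn (f : Paravector n → Op n V)
    (U : Set (Paravector n)) : Prop :=
  IsOpen U ∧ AxiallySymmetric U ∧ ∃ α β, IsStemPair U α β ∧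
    ∀ I ∈ imagSphere n, ∀ u v : ℝ, slicePt I u v ∈ U →
      f (slicePt I u v) = α (u, v) + β (u, v) * scalarOp V I

/-- On `U`, `f` is left slice hyperholomorphic and `g` is its slice derivative: the partial
derivatives `a = ∂/∂u f(u + I v)` and `b = ∂/∂v f(u + I v)` exist, and
`g(u + I v) = ½ (a - I b)`, for every `I ∈ 𝕊`. -/
def IsLeftSliceDerivOn (U : Set (Paravector n)) (f g : Paravector n → Op n V) :
    Prop :=
  LeftSliceHyperholomorphicOn f U ∧
    ∀ I ∈ imagSphere n, ∀ u v : ℝ, slicePt I u v ∈ U → ∃ a b : Op n V,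
      HasDerivAt (fun t => f (slicePt I t v)) a u ∧ HasDerivAt (fun t => f (slicePt I u t)) b v ∧
        g (slicePt I u v) = (1 / 2 : ℝ) • (a - scalarOp V I * b)

/-- On `U`, `f` is right slice hyperholomorphic and `g` is its slice derivative:
`g(u + I v) = ½ (∂/∂u f(u + I v) - ∂/∂v f(u + I v) I)`, for every `I ∈ 𝕊`. -/
def IsRightSliceDerivOn (U : Set (Paravector n)) (f g : Paravector n → Op n V) :
    Prop :=
  RightSliceHyperholomorphicOn f U ∧
    ∀ I ∈ imagSphere n, ∀ u v : ℝ, slicePt I u v ∈ U → ∃ a b : Op n V,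
      HasDerivAt (fun t => f (slicePt I t v)) a u ∧ HasDerivAt (fun t => f (slicePt I u t)) b v ∧
        g (slicePt I u v) = (1 / 2 : ℝ) • (a - b * scalarOp V I)

/-- On `U`, the partial derivative `∂f/∂s₀` with respect to the real part exists and is `g`. -/
def IsRealPartialOn (U : Set (Paravector n)) (f g : Paravector n → Op n V) :
    Prop :=
  ∀ s ∈ U, HasDerivAt (fun t : ℝ => f (s + t • realUnit n)) (g s) 0

/-- For a relation `D f g` that says that `g` is the derivative of `f` on `U`, in some sense:
`g` is the `m`-th iterated derivative of `f` on `U`. -/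
def IsIteratedDerivOn {X E : Type*} (D : (X → E) → (X → E) → Prop) (U : Set X) :
    ℕ → (X → E) → (X → E) → Prop
  | 0, f, g => Set.EqOn f g U
  | m + 1, f, g => ∃ h, IsIteratedDerivOn D U m f h ∧ D h g

end SResolvent

end

/-! Adjoin to the algebra generated by `T` a formal central unit `i` and put `z = u + iv`. Since `(z
- T)(z̄ - T) = T² - 2uT + u² + v²`, the formal resolvent `w = (z - T)⁻¹` is `R(z̄ - T) = a + ib`
with `R` the inverse of the quadratic, `a = R(u - T)` and `b = -vR`. The powers `wᵏ = a_k + i b_k`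
satisfy `dwᵏ/dz = -k wᵏ⁺¹`, and the real form of this identity contains the Cauchy-Riemann system
(`hasFDerivAt_stemPow`).

The star products keep the Clifford coefficients on one side of the powers of `T`, as if they
commuted with `T`. On the slice of `I`, the unit `I` therefore plays the part of `i`: `S_L⁻ᵏ = a_k +
b_k I` and `S_R⁻ᵏ = a_k + I b_k` (`leftResolventPow_slicePt`, `rightResolventPow_slicePt`). No
commutation of `T` with `I` is involved, only that of `T` with `R`.

Hence `∂_u S⁻ᵏ = -k S⁻⁽ᵏ⁺¹⁾` on every slice. By Cauchy-Riemann the slice derivative equals `∂_u`,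
which is also `∂/∂s₀`. Iteration from `k = 1` gives the factor `(-1)^m m!`. -/

namespace SResolvent

/-! ### The stem functions of the resolvent powers, in a Banach algebra -/

section BanachAlgebra

variable {A : Type*} [NormedRing A] [NormedAlgebra ℝ A]

/-- The linear map with the partial derivatives `x` and `y`. -/
noncomputable def partials (x y : A) : ℝ × ℝ →L[ℝ] A :=
  (ContinuousLinearMap.fst ℝ ℝ ℝ).smulRight x + (ContinuousLinearMap.snd ℝ ℝ ℝ).smulRight y

theorem partials_apply (x y : A) (p : ℝ × ℝ) : partials x y p = p.1 • x + p.2 • y := rfl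

theorem hasFDerivAt_mul_partials {f g : ℝ × ℝ → A} {x y x' y' : A} {p : ℝ × ℝ}
    (hf : HasFDerivAt f (partials x y) p) (hg : HasFDerivAt g (partials x' y') p) :
    HasFDerivAt (fun q => f q * g q)
      (partials (f p * x' + x * g p) (f p * y' + y * g p)) p := by
  refine (hf.mul' hg).congr_fderiv (ContinuousLinearMap.ext fun q => ?_)
  simp [partials_apply, mul_add]
  abel

theorem hasDerivAt_fst_of_partials {f : ℝ × ℝ → A} {x y : A} {u v : ℝ}
    (hf : HasFDerivAt f (partials x y) (u, v)) : HasDerivAt (fun t => f (t, v)) x u := by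
  have h := HasFDerivAt.comp_hasDerivAt u hf ((hasDerivAt_id u).prodMk (hasDerivAt_const u v))
  simpa [partials_apply, Function.comp_def] using h

theorem hasDerivAt_snd_of_partials {f : ℝ × ℝ → A} {x y : A} {u v : ℝ}
    (hf : HasFDerivAt f (partials x y) (u, v)) : HasDerivAt (fun t => f (u, t)) y v := by
  have h := HasFDerivAt.comp_hasDerivAt v hf ((hasDerivAt_const v u).prodMk (hasDerivAt_id v))
  simpa [partials_apply, Function.comp_def] using h

/-- `T² - 2 u T + u² + v²`. -/
noncomputable def sliceQuad (T : A) (p : ℝ × ℝ) : A :=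
  T ^ 2 - (2 * p.1) • T + (p.1 ^ 2 + p.2 ^ 2) • (1 : A)

/-- The real part of the formal resolvent `(u + i v - T)⁻¹`. -/
noncomputable def resolventRe (T : A) (p : ℝ × ℝ) : A := Ring.inverse (sliceQuad T p) * (p.1 • (1 : A) - T)

/-- The imaginary part of the formal resolvent `(u + i v - T)⁻¹`. -/
noncomputable def resolventIm (T : A) (p : ℝ × ℝ) : A := -(p.2 • Ring.inverse (sliceQuad T p))

/-- The real and the imaginary part of the formal power `(u + i v - T)⁻ᵏ`. -/
noncomputable def stemPow (T : A) : ℕ → ℝ × ℝ → A × A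
  | 0, _ => (1, 0)
  | k + 1, p =>
    ((stemPow T k p).1 * resolventRe T p - (stemPow T k p).2 * resolventIm T p,
      (stemPow T k p).1 * resolventIm T p + (stemPow T k p).2 * resolventRe T p)

theorem commute_sliceQuad (T : A) (p : ℝ × ℝ) : Commute T (sliceQuad T p) := by
  unfold sliceQuad
  exact (((Commute.refl T).pow_right 2).sub_right ((Commute.refl T).smul_right _)).add_right
    ((Commute.one_right T).smul_right _)

/-- At a non-unit `Ring.inverse` is `0`, so invertibility is not needed. The slice formulas for the
resolvent powers thus hold for all `(u, v)`, and they can be differentiated without restriction to a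
neighbourhood. -/
theorem commute_inverse_of_commute {R : Type*} [MonoidWithZero R] {a b : R} (h : Commute a b) :
    Commute a (Ring.inverse b) := by
  by_cases hb : IsUnit b
  · obtain ⟨w, rfl⟩ := hb
    rw [Ring.inverse_unit]
    exact h.units_inv_right
  · rw [Ring.inverse_non_unit _ hb]
    exact Commute.zero_right a

theorem commute_inverse_sliceQuad (T : A) (p : ℝ × ℝ) :
    Commute T (Ring.inverse (sliceQuad T p)) :=
  commute_inverse_of_commute (commute_sliceQuad T p)

/-- What commutes with `T` and `(T² - 2 u T + u² + v²)⁻¹` commutes with the stem functions. -/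
theorem commute_stemPow {T x : A} {p : ℝ × ℝ} (hT : Commute x T)
    (hR : Commute x (Ring.inverse (sliceQuad T p))) (k : ℕ) :
    Commute x (stemPow T k p).1 ∧ Commute x (stemPow T k p).2 := by
  have ha : Commute x (resolventRe T p) :=
    hR.mul_right (((Commute.one_right x).smul_right _).sub_right hT)
  have hb : Commute x (resolventIm T p) := (hR.smul_right _).neg_right
  induction k with
  | zero => exact ⟨Commute.one_right x, Commute.zero_right x⟩
  | succ k ih =>
    exact ⟨(ih.1.mul_right ha).sub_right (ih.2.mul_right hb),
      (ih.1.mul_right hb).add_right (ih.2.mul_right ha)⟩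

/-- The change `v ↦ -v` conjugates `w`, hence all its powers. -/
theorem stemPow_neg (T : A) (k : ℕ) (u v : ℝ) :
    (stemPow T k (u, -v)).1 = (stemPow T k (u, v)).1 ∧
      (stemPow T k (u, -v)).2 = -(stemPow T k (u, v)).2 := by
  have ha : resolventRe T (u, -v) = resolventRe T (u, v) := by simp [resolventRe, sliceQuad]
  have hb : resolventIm T (u, -v) = -resolventIm T (u, v) := by simp [resolventIm, sliceQuad]
  induction k with
  | zero => simp [stemPow]
  | succ k ih =>
    simp only [stemPow, ha, hb, ih.1, ih.2]
    constructor
    · simp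
    · simp only [mul_neg, neg_mul]; abel

/-- As `(u - T)² + v²` is the quadratic `Q` and `T` commutes with `R = Q⁻¹`, the sum is `R (R Q) =
R`. It serves to express the bare `R` in the derivatives of `R(u - T)` and `vR` by `a` and `b`. -/
theorem resolventRe_sq_add_resolventIm_sq {T : A} {p : ℝ × ℝ} (h : IsUnit (sliceQuad T p)) :
    resolventRe T p * resolventRe T p + resolventIm T p * resolventIm T p
      = Ring.inverse (sliceQuad T p) := by
  set R := Ring.inverse (sliceQuad T p) with hR
  have hc : T * R = R * T := commute_inverse_sliceQuad T p
  have hq : R * sliceQuad T p = 1 := Ring.inverse_mul_cancel _ h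
  have e : resolventRe T p * resolventRe T p + resolventIm T p * resolventIm T p
      = R * (R * sliceQuad T p) := by
    simp only [resolventRe, resolventIm]
    have h1 : (p.1 • (1 : A) - T) * R = R * (p.1 • (1 : A) - T) := by
      simp [sub_mul, mul_sub, hc]
    have h2 : (p.1 • (1 : A) - T) * (p.1 • (1 : A) - T)
        = T ^ 2 - (2 * p.1) • T + (p.1 ^ 2) • (1 : A) := by
      simp only [sub_mul, mul_sub, smul_mul_assoc, mul_smul_comm, one_mul, mul_one, sq T]
      module
    calc R * (p.1 • (1 : A) - T) * (R * (p.1 • (1 : A) - T)) + -(p.2 • R) * -(p.2 • R)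
        = R * ((p.1 • (1 : A) - T) * R) * (p.1 • (1 : A) - T) + (p.2 ^ 2) • (R * R) := by
          simp only [mul_assoc, neg_mul_neg, smul_mul_assoc, mul_smul_comm, smul_smul, sq]
      _ = R * (R * ((p.1 • (1 : A) - T) * (p.1 • (1 : A) - T) + (p.2 ^ 2) • (1 : A))) := by
          rw [h1]; simp only [mul_assoc, mul_add, mul_smul_comm, mul_one]
      _ = _ := by simp only [h2, sliceQuad, add_smul, add_assoc]
  rw [e, hq, mul_one]

theorem commute_resolventRe_resolventIm (T : A) (p : ℝ × ℝ) :
    Commute (resolventRe T p) (resolventIm T p) := by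
  have h := (commute_inverse_sliceQuad T p)
  refine (Commute.smul_right ?_ _).neg_right
  exact (Commute.refl _).mul_left (((Commute.one_left _).smul_left _).sub_left h)

/-! ### Derivatives of the formal resolvent and its powers -/

variable [CompleteSpace A]

/-- From `dR = -R dQ R` with `dQ = 2(u - T) du + 2v dv`; the left factor `R` is absorbed into `a =
R(u - T)` and `b = -vR`. -/
theorem hasFDerivAt_inverse_sliceQuad {T : A} {p : ℝ × ℝ} (h : IsUnit (sliceQuad T p)) :
    HasFDerivAt (fun q => Ring.inverse (sliceQuad T q))
      (partials (-(2 : ℝ) • (resolventRe T p * Ring.inverse (sliceQuad T p)))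
        ((2 : ℝ) • (resolventIm T p * Ring.inverse (sliceQuad T p)))) p := by
  have hq : HasFDerivAt (sliceQuad T)
      (partials ((2 : ℝ) • (p.1 • (1 : A) - T)) ((2 * p.2) • (1 : A))) p := by
    have h1 : HasFDerivAt (fun q : ℝ × ℝ => q.1) (ContinuousLinearMap.fst ℝ ℝ ℝ) p :=
      hasFDerivAt_fst
    have h2 : HasFDerivAt (fun q : ℝ × ℝ => q.2) (ContinuousLinearMap.snd ℝ ℝ ℝ) p :=
      hasFDerivAt_snd
    refine ((((h1.const_mul 2).smul_const T).const_sub (T ^ 2)).add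
      (((h1.pow 2).add (h2.pow 2)).smul_const (1 : A))).congr_fderiv
        (ContinuousLinearMap.ext fun q => ?_)
    simp [partials_apply]
    module
  obtain ⟨w, hw⟩ := h
  have hi := hasFDerivAt_ringInverse (𝕜 := ℝ) w
  rw [hw] at hi
  refine (hi.comp p hq).congr_fderiv (ContinuousLinearMap.ext fun q => ?_)
  have hR : (↑w⁻¹ : A) = Ring.inverse (sliceQuad T p) := by rw [← hw, Ring.inverse_unit]
  simp only [ContinuousLinearMap.comp_apply, neg_apply,
    ContinuousLinearMap.mulLeftRight_apply, partials_apply, resolventRe, resolventIm, hR]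
  simp only [mul_add, add_mul, smul_mul_assoc, mul_smul_comm, mul_one, neg_mul]
  module

/-- Real part of `dw/dz = -w²`. The imaginary part of `w²` is left as `ab + ba`, the shape in which
products expand, so the induction for the powers needs only associativity. -/
theorem hasFDerivAt_resolventRe {T : A} {p : ℝ × ℝ} (h : IsUnit (sliceQuad T p)) :
    HasFDerivAt (resolventRe T)
      (partials (-(resolventRe T p * resolventRe T p - resolventIm T p * resolventIm T p))
        (resolventRe T p * resolventIm T p + resolventIm T p * resolventRe T p)) p := by
  have h1 : HasFDerivAt (fun q : ℝ × ℝ => q.1 • (1 : A) - T) (partials 1 0) p := by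
    have h1 : HasFDerivAt (fun q : ℝ × ℝ => q.1) (ContinuousLinearMap.fst ℝ ℝ ℝ) p :=
      hasFDerivAt_fst
    refine ((h1.smul_const (1 : A)).sub_const T).congr_fderiv
      (ContinuousLinearMap.ext fun q => ?_)
    simp [partials_apply]
  refine (hasFDerivAt_mul_partials (hasFDerivAt_inverse_sliceQuad h) h1).congr_fderiv ?_
  have hs := resolventRe_sq_add_resolventIm_sq h
  have hc : resolventRe T p * resolventIm T p = resolventIm T p * resolventRe T p :=
    commute_resolventRe_resolventIm T p
  simp only [smul_mul_assoc, mul_assoc, mul_one, mul_zero, zero_add]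
  change partials (_ + _ • (_ * resolventRe T p)) (_ • (_ * resolventRe T p)) = _
  rw [hc]
  -- The lone `R`, from differentiating `u - T`, becomes `a² + b²`; together with `-2a²` it gives
  -- `-(a² - b²)`.
  nth_rewrite 1 [← hs]
  congr 1 <;> module

theorem hasFDerivAt_resolventIm {T : A} {p : ℝ × ℝ} (h : IsUnit (sliceQuad T p)) :
    HasFDerivAt (resolventIm T)
      (partials (-(resolventRe T p * resolventIm T p + resolventIm T p * resolventRe T p))
        (-(resolventRe T p * resolventRe T p - resolventIm T p * resolventIm T p))) p := by
  have h2 : HasFDerivAt (fun q : ℝ × ℝ => q.2) (ContinuousLinearMap.snd ℝ ℝ ℝ) p :=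
    hasFDerivAt_snd
  refine (h2.smul (hasFDerivAt_inverse_sliceQuad h)).neg.congr_fderiv ?_
  have hs := resolventRe_sq_add_resolventIm_sq h
  have hc : resolventRe T p * resolventIm T p = resolventIm T p * resolventRe T p :=
    commute_resolventRe_resolventIm T p
  have hb : p.2 • Ring.inverse (sliceQuad T p) = -resolventIm T p := by simp [resolventIm]
  refine ContinuousLinearMap.ext fun q => ?_
  simp only [neg_apply, add_apply,
    smul_apply, ContinuousLinearMap.smulRight_apply, partials_apply,
    ContinuousLinearMap.coe_snd']
  -- The outer factor `v` is absorbed into `R` by `vR = -b`.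
  have e1 : p.2 • (q.1 • -(2 : ℝ) • (resolventRe T p * Ring.inverse (sliceQuad T p))
        + q.2 • (2 : ℝ) • (resolventIm T p * Ring.inverse (sliceQuad T p)))
      = q.1 • (2 : ℝ) • (resolventRe T p * resolventIm T p)
        - q.2 • (2 : ℝ) • (resolventIm T p * resolventIm T p) := by
    have e2 : ∀ x : A, p.2 • (x * Ring.inverse (sliceQuad T p)) = -(x * resolventIm T p) :=
      fun x => by rw [← mul_smul_comm, hb, mul_neg]
    rw [smul_add, smul_comm p.2, smul_comm p.2, smul_comm p.2, smul_comm p.2, e2, e2]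
    module
  rw [e1, ← hs, hc]
  module

/-- The derivative of `z⁻ᵏ` is `-k z⁻ᵏ⁻¹`, in real and imaginary parts. -/
theorem hasFDerivAt_stemPow {T : A} {p : ℝ × ℝ} (h : IsUnit (sliceQuad T p)) (k : ℕ) :
    HasFDerivAt (fun q => (stemPow T k q).1)
      (partials (-(k : ℝ) • (stemPow T (k + 1) p).1) ((k : ℝ) • (stemPow T (k + 1) p).2)) p ∧
    HasFDerivAt (fun q => (stemPow T k q).2)
      (partials (-(k : ℝ) • (stemPow T (k + 1) p).2)
        (-(k : ℝ) • (stemPow T (k + 1) p).1)) p := by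
  induction k with
  | zero =>
    have e : partials (0 : A) 0 = 0 := ContinuousLinearMap.ext fun q => by simp [partials_apply]
    simp only [stemPow, Nat.cast_zero, neg_zero, zero_smul, e]
    exact ⟨hasFDerivAt_const _ _, hasFDerivAt_const _ _⟩
  | succ k ih =>
    have ha := hasFDerivAt_resolventRe h
    have hb := hasFDerivAt_resolventIm h
    constructor
    -- The product rule for `wᵏ · w`: the terms `-k wᵏ⁺¹ · w` and `wᵏ · (-w²)` add up to `-(k+1)
    -- wᵏ⁺²`.
    · refine ((hasFDerivAt_mul_partials ih.1 ha).sub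
        (hasFDerivAt_mul_partials ih.2 hb)).congr_fderiv (ContinuousLinearMap.ext fun q => ?_)
      simp only [sub_apply, partials_apply, stemPow, Nat.cast_succ,
        mul_add, add_mul, mul_sub, sub_mul, smul_mul_assoc, mul_neg, mul_assoc]
      module
    · refine ((hasFDerivAt_mul_partials ih.1 hb).add
        (hasFDerivAt_mul_partials ih.2 ha)).congr_fderiv (ContinuousLinearMap.ext fun q => ?_)
      simp only [add_apply, partials_apply, stemPow, Nat.cast_succ,
        mul_add, add_mul, mul_sub, sub_mul, smul_mul_assoc, mul_neg, mul_assoc]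
      module

end BanachAlgebra

/-! ### Resolvent powers on slices -/

variable {n : ℕ} {V : Type*} [NormedAddCommGroup V] [NormedSpace ℝ V]

/-! ### One-sided evaluation of polynomials and the star powers -/

theorem leftValue_add (T : Op n V) (p q : (Cl n)[X]) :
    leftValue T (p + q) = leftValue T p + leftValue T q :=
  Polynomial.sum_add_index p q _ (by simp) (by simp [mul_add])

theorem rightValue_add (T : Op n V) (p q : (Cl n)[X]) :
    rightValue T (p + q) = rightValue T p + rightValue T q :=
  Polynomial.sum_add_index p q _ (by simp) (by simp [add_mul])

theorem leftValue_monomial (T : Op n V) (k : ℕ) (a : Cl n) :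
    leftValue T (Polynomial.monomial k a) = T ^ k * leftMul n V a :=
  Polynomial.sum_monomial_index _ _ (by simp)

theorem rightValue_monomial (T : Op n V) (k : ℕ) (a : Cl n) :
    rightValue T (Polynomial.monomial k a) = leftMul n V a * T ^ k :=
  Polynomial.sum_monomial_index _ _ (by simp)

/-- Coefficients stand to the right of the powers of `T`, so a constant factor can leave the value
only on the right. A factor `X` leaves on the left, as `T`. -/
theorem leftValue_mul_C (T : Op n V) (p : (Cl n)[X]) (c : Cl n) :
    leftValue T (p * Polynomial.C c) = leftValue T p * leftMul n V c := by
  induction p using Polynomial.induction_on' with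
  | add p q hp hq => rw [add_mul, leftValue_add, leftValue_add, hp, hq, add_mul]
  | monomial k a =>
    rw [Polynomial.monomial_mul_C, leftValue_monomial, leftValue_monomial, map_mul, mul_assoc]

theorem leftValue_mul_X (T : Op n V) (p : (Cl n)[X]) :
    leftValue T (p * Polynomial.X) = T * leftValue T p := by
  induction p using Polynomial.induction_on' with
  | add p q hp hq => rw [add_mul, leftValue_add, leftValue_add, hp, hq, mul_add]
  | monomial k a =>
    rw [Polynomial.monomial_mul_X, leftValue_monomial, leftValue_monomial, pow_succ', mul_assoc]

theorem rightValue_C_mul (T : Op n V) (p : (Cl n)[X]) (c : Cl n) :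
    rightValue T (Polynomial.C c * p) = leftMul n V c * rightValue T p := by
  induction p using Polynomial.induction_on' with
  | add p q hp hq => rw [mul_add, rightValue_add, rightValue_add, hp, hq, mul_add]
  | monomial k a =>
    rw [Polynomial.C_mul_monomial, rightValue_monomial, rightValue_monomial, map_mul, mul_assoc]

theorem rightValue_mul_X (T : Op n V) (p : (Cl n)[X]) :
    rightValue T (p * Polynomial.X) = rightValue T p * T := by
  induction p using Polynomial.induction_on' with
  | add p q hp hq => rw [add_mul, rightValue_add, rightValue_add, hp, hq, add_mul]
  | monomial k a =>
    rw [Polynomial.monomial_mul_X, rightValue_monomial, rightValue_monomial, pow_succ, mul_assoc]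

theorem leftStarPow_zero (x : Paravector n) (T : Op n V) : leftStarPow x T 0 = 1 := by
  rw [leftStarPow, pow_zero, ← Polynomial.C_1, ← Polynomial.monomial_zero_left,
    leftValue_monomial, map_one, pow_zero, mul_one]

theorem rightStarPow_zero (x : Paravector n) (T : Op n V) : rightStarPow x T 0 = 1 := by
  rw [rightStarPow, pow_zero, ← Polynomial.C_1, ← Polynomial.monomial_zero_left,
    rightValue_monomial, map_one, pow_zero, mul_one]

theorem leftStarPow_succ (x : Paravector n) (T : Op n V) (k : ℕ) :
    leftStarPow x T (k + 1) = leftStarPow x T k * scalarOp V x - T * leftStarPow x T k := by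
  -- Adding `p X` to `p (C x - X)` leaves `p C x`, so additivity suffices.
  have h := leftValue_add T
    ((Polynomial.C (toCl x) - Polynomial.X) ^ k * (Polynomial.C (toCl x) - Polynomial.X))
    ((Polynomial.C (toCl x) - Polynomial.X) ^ k * Polynomial.X)
  rw [← mul_add, sub_add_cancel, leftValue_mul_C, leftValue_mul_X, ← pow_succ] at h
  exact eq_sub_of_add_eq h.symm

theorem rightStarPow_succ (x : Paravector n) (T : Op n V) (k : ℕ) :
    rightStarPow x T (k + 1) = scalarOp V x * rightStarPow x T k - rightStarPow x T k * T := by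
  -- The factor is split off on the left, the side on which `rightValue` releases constants.
  have h := rightValue_add T
    ((Polynomial.C (toCl x) - Polynomial.X) * (Polynomial.C (toCl x) - Polynomial.X) ^ k)
    (Polynomial.X * (Polynomial.C (toCl x) - Polynomial.X) ^ k)
  rw [← add_mul, sub_add_cancel, rightValue_C_mul, Polynomial.X_mul, rightValue_mul_X,
    ← pow_succ'] at h
  exact eq_sub_of_add_eq h.symm

theorem leftResolventPow_one (s : Paravector n) (T : Op n V) :
    leftResolventPow 1 s T = leftResolvent s T := by
  rw [leftResolventPow, leftStarPow_succ, leftStarPow_zero, leftResolvent, one_mul, mul_one,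
    pow_one, ← mul_neg, neg_sub]

theorem rightResolventPow_one (s : Paravector n) (T : Op n V) :
    rightResolventPow 1 s T = rightResolvent s T := by
  rw [rightResolventPow, rightStarPow_succ, rightStarPow_zero, rightResolvent, one_mul, mul_one,
    pow_one, ← neg_mul, neg_sub]

/-- `(I, v)` with `I` imaginary describes points `u + I v` of a slice; the direction `I` is of
norm one, unless `v = 0`. -/
noncomputable def IsSliceDir (I : Paravector n) (v : ℝ) : Prop := I 0 = 0 ∧ (‖I‖ = 1 ∨ v = 0)

theorem isSliceDir_of_mem {I : Paravector n} (hI : I ∈ imagSphere n) (v : ℝ) : IsSliceDir I v :=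
  ⟨hI.1, Or.inl hI.2⟩

/-- Real points get the direction `0` with `v = 0`, which also covers `n = 0`, where no imaginary
unit exists. The derivative in `s₀` is needed at such points too. -/
theorem exists_eq_slicePt (s : Paravector n) :
    ∃ I u v, IsSliceDir I v ∧ s = slicePt I u v := by
  set J : Paravector n := s - s 0 • realUnit n with hJ
  have hJ0 : J 0 = 0 := by simp [hJ, realUnit]
  by_cases h : ‖J‖ = 0
  · exact ⟨0, s 0, 0, ⟨rfl, Or.inr rfl⟩, by
      rw [slicePt, zero_smul, add_zero]; exact sub_eq_zero.1 (norm_eq_zero.1 h)⟩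
  · refine ⟨‖J‖⁻¹ • J, s 0, ‖J‖, ⟨by simp [hJ0], Or.inl ?_⟩, ?_⟩
    · rw [norm_smul, norm_inv, norm_norm, inv_mul_cancel₀ h]
    · rw [slicePt, smul_smul, mul_inv_cancel₀ h, one_smul, hJ]; abel

theorem slicePt_add_realUnit (I : Paravector n) (u v t : ℝ) :
    slicePt I u v + t • realUnit n = slicePt I (u + t) v := by
  simp only [slicePt, add_smul]; abel

theorem slicePt_apply_zero {I : Paravector n} (hI : I 0 = 0) (u v : ℝ) :
    slicePt I u v 0 = u := by
  simp [slicePt, realUnit, hI]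

theorem slicePt_apply_succ (I : Paravector n) (u v : ℝ) (j : Fin n) :
    slicePt I u v j.succ = v * I j.succ := by
  simp [slicePt, realUnit]

theorem norm_sq_of_imag {I : Paravector n} (hI : I 0 = 0) :
    ‖I‖ ^ 2 = ∑ j : Fin n, I j.succ ^ 2 := by
  rw [EuclideanSpace.real_norm_sq_eq, Fin.sum_univ_succ, hI]; simp

theorem norm_sq_slicePt {I : Paravector n} {v : ℝ} (hI : IsSliceDir I v) (u : ℝ) :
    ‖slicePt I u v‖ ^ 2 = u ^ 2 + v ^ 2 := by
  rw [EuclideanSpace.real_norm_sq_eq, Fin.sum_univ_succ, slicePt_apply_zero hI.1]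
  simp only [slicePt_apply_succ, mul_pow, ← Finset.mul_sum, ← norm_sq_of_imag hI.1]
  rcases hI.2 with h | h <;> simp [h]

theorem scalarOp_conj_slicePt {I : Paravector n} (hI : I 0 = 0) (u v : ℝ) :
    scalarOp V (conj (slicePt I u v)) = u • (1 : Op n V) - v • scalarOp V I := by
  have h : (fun j : Fin n => conj (slicePt I u v) j.succ) = (-v) • fun j : Fin n => I j.succ := by
    ext j
    simp [conj, slicePt_apply_succ]
  have h0 : conj (slicePt I u v) 0 = u := by simp [conj, slicePt_apply_zero hI]
  rw [scalarOp, scalarOp, toCl, toCl, h, h0, hI, map_zero, zero_add, map_smul, map_add, map_smul,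
    AlgHom.commutes, Algebra.algebraMap_eq_smul_one, neg_smul, sub_eq_add_neg]

theorem scalarOp_mul_self {I : Paravector n} (hI : I 0 = 0) :
    scalarOp V I * scalarOp V I = -(‖I‖ ^ 2 • (1 : Op n V)) := by
  rw [scalarOp, toCl, hI, map_zero, zero_add, ← map_mul, CliffordAlgebra.ι_sq_scalar,
    AlgHom.commutes, Algebra.algebraMap_eq_smul_one, norm_sq_of_imag hI, ← neg_smul]
  congr 1
  simp [negSq, QuadraticMap.weightedSumSquares_apply, sq]

/-- The substitute for `I² = -1` that survives at real points. It is enough, because `s̄` contains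
`I` only with the factor `v`. -/
theorem smul_scalarOp_mul_self {I : Paravector n} {v : ℝ} (hI : IsSliceDir I v) :
    v • (scalarOp V I * scalarOp V I) = -(v • (1 : Op n V)) := by
  rw [scalarOp_mul_self hI.1]
  rcases hI.2 with h | h <;> simp [h]

theorem quadOp_slicePt {I : Paravector n} {v : ℝ} (hI : IsSliceDir I v) (u : ℝ) (T : Op n V) :
    quadOp (slicePt I u v) T = sliceQuad T (u, v) := by
  rw [quadOp, sliceQuad, norm_sq_slicePt hI, slicePt_apply_zero hI.1]

theorem isUnit_sliceQuad {I : Paravector n} {u v : ℝ} {T : Op n V} (hI : IsSliceDir I v)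
    (h : slicePt I u v ∈ sResolventSet T) : IsUnit (sliceQuad T (u, v)) := by
  rw [← quadOp_slicePt hI]
  exact not_not.1 h

/-- Each step multiplies by `s̄` on the right and by `T` and `R` on the left. The latter commute
with the stem functions, so `I` stays at the far right and `R(s̄ - T)` acts as `w`. -/
theorem leftResolventPow_slicePt {I : Paravector n} {v : ℝ} (hI : IsSliceDir I v) (u : ℝ)
    (T : Op n V) (k : ℕ) :
    leftResolventPow k (slicePt I u v) T
      = (stemPow T k (u, v)).1 + (stemPow T k (u, v)).2 * scalarOp V I := by
  rw [leftResolventPow, quadOp_slicePt hI]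
  set J := scalarOp V I
  have hJ : v • (J * J) = -(v • (1 : Op n V)) := smul_scalarOp_mul_self hI
  have hTR := commute_inverse_sliceQuad T (u, v)
  have hT := commute_stemPow (Commute.refl T) hTR
  have hR := commute_stemPow hTR.symm (Commute.refl _)
  induction k with
  | zero => simp [leftStarPow_zero, stemPow]
  | succ k ih =>
    rw [leftStarPow_succ, scalarOp_conj_slicePt hI.1, pow_succ']
    simp only [stemPow, resolventRe, resolventIm]
    specialize hT k
    specialize hR k
    set R := Ring.inverse (sliceQuad T (u, v))
    set a := (stemPow T k (u, v)).1
    set b := (stemPow T k (u, v)).2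
    -- `R ^ k` is moved past `T` to meet the star power, so that the induction hypothesis applies.
    have e : R * R ^ k * (leftStarPow (conj (slicePt I u v)) T k * (u • 1 - v • J)
          - T * leftStarPow (conj (slicePt I u v)) T k)
        = R * ((a + b * J) * (u • 1 - v • J)) - R * (T * (a + b * J)) := by
      rw [← ih, mul_sub, mul_assoc, mul_assoc, mul_assoc, ← mul_assoc (R ^ k) T,
        ((hTR.pow_right k).eq).symm, mul_assoc]
    have hb : v • (R * (b * (J * J))) = -(v • (R * b)) := by
      rw [← mul_smul_comm, ← mul_smul_comm, hJ, mul_neg, mul_neg, mul_smul_comm, mul_smul_comm,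
        mul_one]
    have h1 : a * (R * T) = R * (T * a) := by
      rw [← mul_assoc, ← hR.1.eq, mul_assoc, ← hT.1.eq]
    have h2 : b * (T * J) = T * (b * J) := by
      rw [← mul_assoc, ← hT.2.eq, mul_assoc]
    have h3 : ∀ x, b * (R * x) = R * (b * x) := fun x => by
      rw [← mul_assoc, ← hR.2.eq, mul_assoc]
    rw [e]
    simp only [mul_add, add_mul, mul_sub, sub_mul, mul_smul_comm, smul_mul_assoc, mul_one,
      mul_assoc, mul_neg, neg_mul, smul_add, h1, h2, hb, h3, ← hR.1.eq, ← hR.2.eq]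
    module

/-- Here `T` and `R` enter on the right, as does the new factor in `stemPow`; hence `TR = RT` is the
only commutation needed. -/
theorem rightResolventPow_slicePt {I : Paravector n} {v : ℝ} (hI : IsSliceDir I v) (u : ℝ)
    (T : Op n V) (k : ℕ) :
    rightResolventPow k (slicePt I u v) T
      = (stemPow T k (u, v)).1 + scalarOp V I * (stemPow T k (u, v)).2 := by
  rw [rightResolventPow, quadOp_slicePt hI]
  set J := scalarOp V I
  have hJ : v • (J * J) = -(v • (1 : Op n V)) := smul_scalarOp_mul_self hI
  have hTR := commute_inverse_sliceQuad T (u, v)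
  induction k with
  | zero => simp [rightStarPow_zero, stemPow]
  | succ k ih =>
    rw [rightStarPow_succ, scalarOp_conj_slicePt hI.1, pow_succ]
    simp only [stemPow, resolventRe, resolventIm]
    set R := Ring.inverse (sliceQuad T (u, v))
    set a := (stemPow T k (u, v)).1
    set b := (stemPow T k (u, v)).2
    have e : ((u • 1 - v • J) * rightStarPow (conj (slicePt I u v)) T k
          - rightStarPow (conj (slicePt I u v)) T k * T) * (R ^ k * R)
        = (u • 1 - v • J) * (a + J * b) * R - (a + J * b) * (R * T) := by
      rw [← ih, sub_mul, mul_assoc _ T (R ^ k * R), ← mul_assoc T (R ^ k) R,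
        (hTR.pow_right k).eq, mul_assoc _ T R, hTR.eq]
      simp only [mul_assoc]
    have hb : v • (J * (J * (b * R))) = -(v • (b * R)) := by
      rw [← mul_assoc, ← smul_mul_assoc, hJ, neg_mul, smul_mul_assoc, one_mul]
    rw [e]
    simp only [mul_add, add_mul, mul_sub, sub_mul, mul_smul_comm, smul_mul_assoc, mul_one,
      one_mul, mul_assoc, mul_neg, hb]
    module

/-! ### Derivatives of the resolvent powers -/

theorem axiallySymmetric_sResolventSet (T : Op n V) : AxiallySymmetric (sResolventSet T) := by
  intro u v I hI J hJ h
  have h' := isUnit_sliceQuad (isSliceDir_of_mem hI v) h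
  rw [← quadOp_slicePt (isSliceDir_of_mem hJ v)] at h'
  exact not_not.2 h'

variable [CompleteSpace V]

theorem isOpen_sResolventSet (T : Op n V) : IsOpen (sResolventSet T) := by
  have hc : Continuous fun s : Paravector n => quadOp s T := by
    unfold quadOp
    fun_prop
  have e : sResolventSet T = (fun s => quadOp s T) ⁻¹' {x | IsUnit x} := by
    ext s; simp [sResolventSet, sSpectrum]
  rw [e]
  exact Units.isOpen.preimage hc

/-- The multiples of the stem functions form stem pairs on the `S`-resolvent set, if there is
an imaginary direction. -/
theorem isStemPair_stemPow (T : Op n V) (hn : (imagSphere n).Nonempty) (c : ℝ) (k : ℕ) :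
    IsStemPair (sResolventSet T) (fun p => c • (stemPow T k p).1)
      (fun p => c • (stemPow T k p).2) := by
  obtain ⟨I, hI⟩ := hn
  have hd : ∀ p ∈ sliceDomain (sResolventSet T), IsUnit (sliceQuad T p) := fun p hp =>
    -- One direction suffices, since the quadratic depends only on `(u, v)`.
    isUnit_sliceQuad (isSliceDir_of_mem hI p.2) (hp I hI)
  have h1 := fun p hp => (hasFDerivAt_stemPow (hd p hp) k).1.fun_const_smul c
  have h2 := fun p hp => (hasFDerivAt_stemPow (hd p hp) k).2.fun_const_smul c
  refine ⟨fun p hp => (h1 p hp).differentiableAt, fun p hp => (h2 p hp).differentiableAt,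
    fun u v _ => ?_, fun u v _ => ?_, fun p hp => ?_, fun p hp => ?_⟩
  · simp only [(stemPow_neg T k u v).1]
  · simp only [(stemPow_neg T k u v).2, smul_neg]
  · rw [(h1 p hp).fderiv, (h2 p hp).fderiv]
    simp [partials_apply]
  · rw [(h1 p hp).fderiv, (h2 p hp).fderiv]
    simp [partials_apply]

theorem rightSliceHyperholomorphicOn_leftResolventPow (T : Op n V) (c : ℝ) (k : ℕ) :
    RightSliceHyperholomorphicOn (fun s => c • leftResolventPow k s T) (sResolventSet T) := by
  refine ⟨isOpen_sResolventSet T, axiallySymmetric_sResolventSet T, ?_⟩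
  rcases (imagSphere n).eq_empty_or_nonempty with hn | hn
  -- Without imaginary units `sliceDomain` is vacuously the whole plane, where the stem functions
  -- may fail to be differentiable. The representation is then vacuous as well, and the zero pair
  -- serves.
  · exact ⟨0, 0, by constructor <;> simp [Pi.zero_def], by simp [hn]⟩
  · refine ⟨_, _, isStemPair_stemPow T hn c k, fun I hI u v _ => ?_⟩
    simp only [leftResolventPow_slicePt (isSliceDir_of_mem hI v), smul_add, smul_mul_assoc]

theorem leftSliceHyperholomorphicOn_rightResolventPow (T : Op n V) (c : ℝ) (k : ℕ) :
    LeftSliceHyperholomorphicOn (fun s => c • rightResolventPow k s T) (sResolventSet T) := by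
  refine ⟨isOpen_sResolventSet T, axiallySymmetric_sResolventSet T, ?_⟩
  rcases (imagSphere n).eq_empty_or_nonempty with hn | hn
  · exact ⟨0, 0, by constructor <;> simp [Pi.zero_def], by simp [hn]⟩
  · refine ⟨_, _, isStemPair_stemPow T hn c k, fun I hI u v _ => ?_⟩
    simp only [rightResolventPow_slicePt (isSliceDir_of_mem hI v), smul_add, mul_smul_comm]

theorem hasDerivAt_leftResolventPow_fst {T : Op n V} {I : Paravector n} {u v : ℝ}
    (hI : IsSliceDir I v) (h : slicePt I u v ∈ sResolventSet T) (k : ℕ) :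
    HasDerivAt (fun t => leftResolventPow k (slicePt I t v) T)
      (-(k : ℝ) • leftResolventPow (k + 1) (slicePt I u v) T) u := by
  have hk := hasFDerivAt_stemPow (isUnit_sliceQuad hI h) k
  simp only [leftResolventPow_slicePt hI, smul_add, ← smul_mul_assoc]
  exact (hasDerivAt_fst_of_partials hk.1).add
    ((hasDerivAt_fst_of_partials hk.2).mul_const (scalarOp V I))

theorem hasDerivAt_rightResolventPow_fst {T : Op n V} {I : Paravector n} {u v : ℝ}
    (hI : IsSliceDir I v) (h : slicePt I u v ∈ sResolventSet T) (k : ℕ) :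
    HasDerivAt (fun t => rightResolventPow k (slicePt I t v) T)
      (-(k : ℝ) • rightResolventPow (k + 1) (slicePt I u v) T) u := by
  have hk := hasFDerivAt_stemPow (isUnit_sliceQuad hI h) k
  simp only [rightResolventPow_slicePt hI, smul_add, ← mul_smul_comm]
  exact (hasDerivAt_fst_of_partials hk.1).add
    ((hasDerivAt_fst_of_partials hk.2).const_mul (scalarOp V I))

/-- Cauchy-Riemann gives `∂_v f = (∂_u f) I`, so `-(∂_v f) I = ∂_u f` and the mean of the two terms
is `∂_u f`. The factor `c` keeps the family closed under differentiation. -/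
theorem isRightSliceDerivOn_leftResolventPow (T : Op n V) (c : ℝ) (k : ℕ) :
    IsRightSliceDerivOn (sResolventSet T) (fun s => c • leftResolventPow k s T)
      (fun s => (c * -(k : ℝ)) • leftResolventPow (k + 1) s T) := by
  refine ⟨rightSliceHyperholomorphicOn_leftResolventPow T c k, fun I hI u v h => ?_⟩
  have hd := isSliceDir_of_mem hI
  have hk := hasFDerivAt_stemPow (isUnit_sliceQuad (hd v) h) k
  have hv : HasDerivAt (fun t => leftResolventPow k (slicePt I u t) T)
      ((k : ℝ) • (stemPow T (k + 1) (u, v)).2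
        + -(k : ℝ) • (stemPow T (k + 1) (u, v)).1 * scalarOp V I) v := by
    simp only [leftResolventPow_slicePt (hd _)]
    exact (hasDerivAt_snd_of_partials hk.1).add
      ((hasDerivAt_snd_of_partials hk.2).mul_const (scalarOp V I))
  refine ⟨_, _, (hasDerivAt_leftResolventPow_fst (hd v) h k).const_smul c, hv.const_smul c, ?_⟩
  simp only [leftResolventPow_slicePt (hd v), smul_mul_assoc, add_mul, mul_assoc,
    scalarOp_mul_self hI.1, hI.2, mul_neg, one_pow, one_smul, mul_one]
  module

theorem isLeftSliceDerivOn_rightResolventPow (T : Op n V) (c : ℝ) (k : ℕ) :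
    IsLeftSliceDerivOn (sResolventSet T) (fun s => c • rightResolventPow k s T)
      (fun s => (c * -(k : ℝ)) • rightResolventPow (k + 1) s T) := by
  refine ⟨leftSliceHyperholomorphicOn_rightResolventPow T c k, fun I hI u v h => ?_⟩
  have hd := isSliceDir_of_mem hI
  have hk := hasFDerivAt_stemPow (isUnit_sliceQuad (hd v) h) k
  have hv : HasDerivAt (fun t => rightResolventPow k (slicePt I u t) T)
      ((k : ℝ) • (stemPow T (k + 1) (u, v)).2
        + scalarOp V I * (-(k : ℝ) • (stemPow T (k + 1) (u, v)).1)) v := by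
    simp only [rightResolventPow_slicePt (hd _)]
    exact (hasDerivAt_snd_of_partials hk.1).add
      ((hasDerivAt_snd_of_partials hk.2).const_mul (scalarOp V I))
  refine ⟨_, _, (hasDerivAt_rightResolventPow_fst (hd v) h k).const_smul c, hv.const_smul c, ?_⟩
  have hJ : ∀ x, scalarOp V I * (scalarOp V I * x) = -x := fun x => by
    rw [← mul_assoc, scalarOp_mul_self hI.1, hI.2, one_pow, one_smul, neg_one_mul]
  simp only [rightResolventPow_slicePt (hd v), mul_smul_comm, mul_add, hJ]
  module

theorem isRealPartialOn_leftResolventPow (T : Op n V) (c : ℝ) (k : ℕ) :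
    IsRealPartialOn (sResolventSet T) (fun s => c • leftResolventPow k s T)
      (fun s => (c * -(k : ℝ)) • leftResolventPow (k + 1) s T) := by
  intro s hs
  obtain ⟨I, u, v, hI, rfl⟩ := exists_eq_slicePt s
  simp only [slicePt_add_realUnit, mul_smul]
  have h := hasDerivAt_leftResolventPow_fst hI hs k
  exact (HasDerivAt.comp_const_add (f := fun t => leftResolventPow k (slicePt I t v) T) u 0
    (by rwa [add_zero])).const_smul c

theorem isRealPartialOn_rightResolventPow (T : Op n V) (c : ℝ) (k : ℕ) :
    IsRealPartialOn (sResolventSet T) (fun s => c • rightResolventPow k s T)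
      (fun s => (c * -(k : ℝ)) • rightResolventPow (k + 1) s T) := by
  intro s hs
  obtain ⟨I, u, v, hI, rfl⟩ := exists_eq_slicePt s
  simp only [slicePt_add_realUnit, mul_smul]
  have h := hasDerivAt_rightResolventPow_fst hI hs k
  exact (HasDerivAt.comp_const_add (f := fun t => rightResolventPow k (slicePt I t v) T) u 0
    (by rwa [add_zero])).const_smul c

/-- A family with `D (c f_k) (-c k f_{k+1})` has the iterated derivatives `(-1)^m m! f_{m+1}`
of `f_1`. -/
theorem isIteratedDerivOn_of_forall {X E : Type*} [AddCommGroup E] [Module ℝ E]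
    {D : (X → E) → (X → E) → Prop} (U : Set X) {F : ℕ → X → E} {f : X → E}
    (hD : ∀ (c : ℝ) (k : ℕ), D (fun s => c • F k s) (fun s => (c * -(k : ℝ)) • F (k + 1) s))
    (h1 : ∀ s, F 1 s = f s) (m : ℕ) :
    IsIteratedDerivOn D U m f (fun s => ((-1 : ℝ) ^ m * (m ! : ℝ)) • F (m + 1) s) := by
  induction m with
  | zero => intro s _; simp [h1]
  | succ m ih =>
    refine ⟨_, ih, ?_⟩
    -- The `m`-th derivative is a multiple of `F (m + 1)`, so the next factor is `-(m + 1)`.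
    convert hD ((-1 : ℝ) ^ m * (m ! : ℝ)) (m + 1) using 3
    rw [Nat.factorial_succ]
    push_cast
    ring

end SResolvent

theorem proposition6p5 (n : ℕ) {V : Type*} [NormedAddCommGroup V] [NormedSpace ℝ V]
    [CompleteSpace V] (T : SResolvent.Op n V)
    (hT : T ∈ SResolvent.paravectorOperators n V) (m : ℕ) :
    (SResolvent.IsIteratedDerivOn (SResolvent.IsRightSliceDerivOn (SResolvent.sResolventSet T))
        (SResolvent.sResolventSet T) m (fun s => SResolvent.leftResolvent s T)
        (fun s => ((-1 : ℝ) ^ m * (m ! : ℝ)) • SResolvent.leftResolventPow (m + 1) s T) ∧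
      SResolvent.IsIteratedDerivOn (SResolvent.IsRealPartialOn (SResolvent.sResolventSet T))
        (SResolvent.sResolventSet T) m (fun s => SResolvent.leftResolvent s T)
        (fun s => ((-1 : ℝ) ^ m * (m ! : ℝ)) • SResolvent.leftResolventPow (m + 1) s T)) ∧
    (SResolvent.IsIteratedDerivOn (SResolvent.IsLeftSliceDerivOn (SResolvent.sResolventSet T))
        (SResolvent.sResolventSet T) m (fun s => SResolvent.rightResolvent s T)
        (fun s => ((-1 : ℝ) ^ m * (m ! : ℝ)) • SResolvent.rightResolventPow (m + 1) s T) ∧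
      SResolvent.IsIteratedDerivOn (SResolvent.IsRealPartialOn (SResolvent.sResolventSet T))
        (SResolvent.sResolventSet T) m (fun s => SResolvent.rightResolvent s T)
        (fun s => ((-1 : ℝ) ^ m * (m ! : ℝ)) • SResolvent.rightResolventPow (m + 1) s T)) := by
  exact ⟨⟨SResolvent.isIteratedDerivOn_of_forall _
        (F := fun k s => SResolvent.leftResolventPow k s T)
        (SResolvent.isRightSliceDerivOn_leftResolventPow T)
        (fun s => SResolvent.leftResolventPow_one s T) m,
      SResolvent.isIteratedDerivOn_of_forall _
        (F := fun k s => SResolvent.leftResolventPow k s T)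
        (SResolvent.isRealPartialOn_leftResolventPow T)
        (fun s => SResolvent.leftResolventPow_one s T) m⟩,
    SResolvent.isIteratedDerivOn_of_forall _
        (F := fun k s => SResolvent.rightResolventPow k s T)
        (SResolvent.isLeftSliceDerivOn_rightResolventPow T)
        (fun s => SResolvent.rightResolventPow_one s T) m,
      SResolvent.isIteratedDerivOn_of_forall _
        (F := fun k s => SResolvent.rightResolventPow k s T)
        (SResolvent.isRealPartialOn_rightResolventPow T)
        (fun s => SResolvent.rightResolventPow_one s T) m⟩
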